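/- Let $n\ge 1$ and let $C_n$ be the set of compositions $c=(c_1,\dots,c_\ell)$ of $n$ (tuples of positive integers with sum $n$). For $0\le j\le n-1$ define $T_j:C_n\to C_n$ by $$T_j(c)=\begin{cases}(1,c_1,\dots,c_{\ell-1},c_\ell-1)&\text{if } j=0,\\ (c_1,\dots,c_{j-1},c_j+1,c_{j+1},\dots,c_{\ell-1},c_\ell-1)&\text{if } 1\le j\le \ell-1,\\ c&\text{if } j\ge \ell,\end{cases}$$ where the last part is deleted in the first two cases if $c_\ell=1$. For real rates $x_0,\dots,x_{n-1}\ge 0$ with $x_0>0$ and (if $n\ge2$) $x_1>0$, let $Y^{(n)}$ be the continuous-time Markov chain on $C_n$ that moves from $c$ to $T_j(c)$ at rate $x_j$, for each $0\le j\le n-1$. Then there are unique rational functions $\pi_c\in\mathbb{Q}(x_0,\dots,x_{n-1})$, $c\in C_n$, such that for all such rates each $\pi_c$, written in lowest terms, has nonzero denominator at $(x_0,\dots,x_{n-1})$ and the values $\pi_c(x_0,\dots,x_{n-1})$, $c\in C_n$, form the unique stationary distribution of $Y^{(n)}$. Write each $\pi_c$ in lowest terms as a quotient of two polynomials in $\mathbb{Z}[x_0,\dots,x_{n-1}]$,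 and let the partition function $\mathcal Z(Y^{(n)})$ be the least common multiple in $\mathbb{Z}[x_0,\dots,x_{n-1}]$ of the denominators of the $\pi_c$, $c\in C_n$, which is determined up to sign. Then, up to sign, $$\mathcal Z(Y^{(n)})=\prod_{k=1}^{n-1}y_k^{\,n-k},\qquad y_k=x_0+x_1+\cdots+x_k .$$ -/

import Mathlib

namespace HilbertGalton

/-- Remove one ball from the last bin; the last bin is deleted if it becomes empty. -/
def decLast : List ℕ → List ℕ
  | [] => []
  | [a] => if a = 1 then [] else [a - 1]
  | a :: b :: l => a :: decLast (b :: l)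

theorem decLast_pos : ∀ l : List ℕ, (∀ a ∈ l, 0 < a) → ∀ a ∈ decLast l, 0 < a
  | [], _ => by simp [decLast]
  | [a], h => by
      have := h a (by simp)
      unfold decLast
      split_ifs <;> simp
      omega
  | a :: b :: l, h => by
      intro x hx
      simp only [decLast, List.mem_cons] at hx
      rcases hx with rfl | hx
      · exact h _ (by simp)
      · exact decLast_pos (b :: l) (fun y hy => h y (List.mem_cons_of_mem _ hy)) x hx

theorem decLast_sum : ∀ l : List ℕ, (∀ a ∈ l, 0 < a) → l ≠ [] → (decLast l).sum + 1 = l.sum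
  | [], _, h => (h rfl).elim
  | [a], h, _ => by
      have := h a (by simp)
      unfold decLast
      split_ifs <;> simp <;> omega
  | a :: b :: l, h, _ => by
      have := decLast_sum (b :: l) (fun y hy => h y (List.mem_cons_of_mem _ hy)) (by simp)
      simp only [decLast, List.sum_cons] at this ⊢
      omega

theorem modify_pos : ∀ (l : List ℕ) (i : ℕ), (∀ a ∈ l, 0 < a) →
    ∀ a ∈ l.modify i (· + 1), 0 < a
  | [], _, _ => by simp
  | b :: l, 0, h => by
      intro x hx
      simp only [List.modify_zero_cons, List.mem_cons] at hx
      rcases hx with rfl | hx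
      · omega
      · exact h _ (List.mem_cons_of_mem _ hx)
  | b :: l, i + 1, h => by
      intro x hx
      simp only [List.modify_succ_cons, List.mem_cons] at hx
      rcases hx with rfl | hx
      · exact h _ (by simp)
      · exact modify_pos l i (fun y hy => h y (List.mem_cons_of_mem _ hy)) x hx

theorem modify_sum : ∀ (l : List ℕ) (i : ℕ), i < l.length →
    (l.modify i (· + 1)).sum = l.sum + 1
  | [], _, h => by simp at h
  | b :: l, 0, _ => by simp only [List.modify_zero_cons, List.sum_cons]; omega
  | b :: l, i + 1, h => by
      have := modify_sum l i (by simpa using h)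
      simp only [List.modify_succ_cons, List.sum_cons]
      omega

/-- The map `T_j` on the list of parts `(c_1, …, c_ℓ)`. Bin `j` is at list position `j - 1`;
when `1 ≤ j ≤ ℓ - 1` it is not the last bin. -/
def moveBlocks (j : ℕ) (l : List ℕ) : List ℕ :=
  if j = 0 then 1 :: decLast l
  else if j < l.length then decLast (l.modify (j - 1) (· + 1))
  else l

/-- The map `T_j`, `0 ≤ j ≤ n - 1`, on the compositions of `n`. -/
def move {n : ℕ} (j : Fin n) (c : Composition n) : Composition n where
  blocks := moveBlocks j c.blocks
  blocks_pos := by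
    intro a ha
    have hpos : ∀ b ∈ c.blocks, 0 < b := fun b hb => c.blocks_pos hb
    unfold moveBlocks at ha
    split_ifs at ha with h1 h2
    · rcases List.mem_cons.1 ha with rfl | ha
      · exact Nat.one_pos
      · exact decLast_pos _ hpos _ ha
    · exact decLast_pos _ (modify_pos _ _ hpos) _ ha
    · exact hpos _ ha
  blocks_sum := by
    have hpos : ∀ b ∈ c.blocks, 0 < b := fun b hb => c.blocks_pos hb
    have hs := c.blocks_sum
    have hj := j.2
    have hne : c.blocks ≠ [] := by
      intro h
      rw [h] at hs
      simp only [List.sum_nil] at hs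
      omega
    unfold moveBlocks
    split_ifs with h1 h2
    · have := decLast_sum _ hpos hne
      simp only [List.sum_cons]
      omega
    · have h3 := modify_sum c.blocks ((j : ℕ) - 1) (by omega)
      have h4 : c.blocks.modify ((j : ℕ) - 1) (· + 1) ≠ [] := by
        intro h
        rw [h] at h3
        simp at h3
      have := decLast_sum _ (modify_pos _ _ hpos) h4
      omega
    · exact hs

/-- The generator of the chain `Y^(n)`: from `c` the chain makes the transition to `T_j(c)` at
rate `x_j`, for each `0 ≤ j ≤ n - 1`. The entry `(c, d)` is the total rate of the transitions
that lead from `c` to `d`, minus, on the diagonal, the total rate of all transitions. -/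
def generator {n : ℕ} (x : Fin n → ℝ) : Matrix (Composition n) (Composition n) ℝ :=
  fun c d => (∑ j, if move j c = d then x j else 0) - (if c = d then ∑ j, x j else 0)

/-- `π` is a stationary distribution of `Y^(n)` with rates `x`: a probability vector with
`π Q = 0`, where `Q` is the generator. -/
structure IsStationary {n : ℕ} (x : Fin n → ℝ) (π : Composition n → ℝ) : Prop where
  nonneg : ∀ c, 0 ≤ π c
  sum_eq_one : ∑ c, π c = 1
  balance : Matrix.vecMul π (generator x) = 0

/-- The standing assumption on the rates: all are nonnegative, `x_0` and `x_1` are positive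
(there is no `x_1` when `n = 1`). -/
def Admissible {n : ℕ} (x : Fin n → ℝ) : Prop :=
  (∀ i, 0 ≤ x i) ∧ ∀ i : Fin n, (i : ℕ) ≤ 1 → 0 < x i

/-- Rational functions in the indeterminates `x_0, …, x_{n-1}`, as the fraction field of
`ℤ[x_0, …, x_{n-1}]`. -/
abbrev RatFun (n : ℕ) : Type := FractionRing (MvPolynomial (Fin n) ℤ)

/-- Numerator of a rational function in lowest terms. -/
noncomputable def num {n : ℕ} (r : RatFun n) : MvPolynomial (Fin n) ℤ :=
  IsFractionRing.num (MvPolynomial (Fin n) ℤ) r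

/-- Denominator of a rational function in lowest terms (determined up to sign). -/
noncomputable def den {n : ℕ} (r : RatFun n) : MvPolynomial (Fin n) ℤ :=
  (IsFractionRing.den (MvPolynomial (Fin n) ℤ) r : MvPolynomial (Fin n) ℤ)

/-- The rational function `r` is defined at the real point `x` and takes the value `v` there. -/
def HasValueAt {n : ℕ} (r : RatFun n) (x : Fin n → ℝ) (v : ℝ) : Prop :=
  MvPolynomial.aeval x (den r) ≠ 0 ∧
    v = MvPolynomial.aeval x (num r) / MvPolynomial.aeval x (den r)

/-- The rational functions `r c` are the stationary probabilities of `Y^(n)`: for all admissible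
rates `x`, the vector of the values `r c (x)` is defined and is the one and only stationary
distribution. -/
def IsStationaryRatFun (n : ℕ) (r : Composition n → RatFun n) : Prop :=
  ∀ x : Fin n → ℝ, Admissible x → ∀ π : Composition n → ℝ,
    IsStationary x π ↔ ∀ c, HasValueAt (r c) x (π c)

/-- `Z` is a least common multiple of the family `f`. -/
def IsLeastCommonMultiple {ι R : Type*} [CommRing R] (f : ι → R) (Z : R) : Prop :=
  (∀ i, f i ∣ Z) ∧ ∀ W, (∀ i, f i ∣ W) → Z ∣ W

/-- `Z` is a partition function of `Y^(n)`: a least common multiple in `ℤ[x_0, …, x_{n-1}]` of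
the denominators of the stationary probabilities, these being written in lowest terms. -/
def IsPartitionFunction (n : ℕ) (Z : MvPolynomial (Fin n) ℤ) : Prop :=
  ∃ r : Composition n → RatFun n,
    IsStationaryRatFun n r ∧ IsLeastCommonMultiple (fun c => den (r c)) Z

/-- The polynomial `y_k = x_0 + x_1 + ⋯ + x_k`, for `k ≤ n - 1`. -/
noncomputable def y (n k : ℕ) : MvPolynomial (Fin n) ℤ :=
  ∑ i ∈ (Finset.univ : Finset (Fin n)).filter (fun i => i.val ≤ k), MvPolynomial.X i

end HilbertGalton

/-! Let `b` be the composition left after removing the last ball of `c`. For `j ≤ b.length`, the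
move `T_j` sends `c` to `b` with a ball added to bin `j`; every larger `j` fixes `c`. So targets and
rates depend on `b` alone, and the total rate, self-loops included, is `y_k` with `k = b.length`.
Stationarity therefore reads `y_k * p d = inflow`, where `k` is the length of `decLast d` and the
inflow involves only the law of `b` (`balanced_succ_iff`). That marginal law is itself stationary
for one ball fewer (`Balanced.marginal`). This gives a recursion on the number of balls that proves
existence and uniqueness and yields the formula `weight`.

Each recursion step divides by a single `y_k`, so passing to compositions of `n + 2` multiplies a
common denominator by at most `y_1 ⋯ y_(n+1)`. Iterating gives the upper bound `∏ y_k ^ (n + 1 - k)`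
for compositions of `n + 1`. The bound is attained prime by prime: the hook `(a + 1, 1, …, 1)` with
`k ≥ 1` trailing ones has probability `(x_1 / y_k) ^ a * ∏_{i ≤ k} x_0 / y_i`, where `y_k` has
exponent `a + 1 = n + 1 - k`. The `y_k` with `k ≥ 1` are pairwise non-associated primes dividing
neither `x_0` nor `x_1`, so nothing cancels. -/

namespace HilbertGalton

/-! ### Compositions as lists: adding balls, removing the last ball. -/

open Finset

/-- The compositions of `n`, as lists of parts. -/
noncomputable def parts (n : ℕ) : Finset (List ℕ) :=
  (univ : Finset (Composition n)).image Composition.blocks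

/-- Add a ball to bin `j`, or a new bin with one ball on the left if `j = 0`. -/
def addBall (j : ℕ) (l : List ℕ) : List ℕ :=
  if j = 0 then 1 :: l else l.modify (j - 1) (· + 1)

/-- Add a ball to the last bin. -/
def incLast (l : List ℕ) : List ℕ := addBall l.length l

theorem mem_parts {n : ℕ} {l : List ℕ} : l ∈ parts n ↔ (∀ a ∈ l, 0 < a) ∧ l.sum = n := by
  simp only [parts, mem_image, mem_univ, true_and]
  constructor
  · rintro ⟨c, rfl⟩
    exact ⟨fun a ha => c.blocks_pos ha, c.blocks_sum⟩
  · rintro ⟨h1, h2⟩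
    exact ⟨⟨l, fun {a} ha => h1 a ha, h2⟩, rfl⟩

theorem ne_nil_of_mem_parts {n : ℕ} {l : List ℕ} (h : l ∈ parts (n + 1)) : l ≠ [] := by
  rintro rfl
  simpa using (mem_parts.1 h).2

theorem length_le_of_mem_parts {n : ℕ} {l : List ℕ} (h : l ∈ parts n) : l.length ≤ n := by
  rw [← (mem_parts.1 h).2]
  exact List.length_le_sum_of_one_le _ fun a ha => (mem_parts.1 h).1 a ha

theorem length_pos_of_mem_parts {n : ℕ} {l : List ℕ} (h : l ∈ parts (n + 1)) : 0 < l.length :=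
  List.length_pos_iff.2 (ne_nil_of_mem_parts h)

theorem parts_one : parts 1 = {[1]} := by
  ext l
  rw [mem_parts, mem_singleton]
  constructor
  · rintro ⟨h1, h2⟩
    match l, h1, h2 with
    | [], _, h => simp at h
    | [a], _, h => simpa using h
    | a :: b :: l, h1, h =>
      have := h1 a (by simp)
      have := h1 b (by simp)
      simp only [List.sum_cons] at h
      omega
  · rintro rfl
    simp

theorem sum_blocks {M : Type*} [AddCommMonoid M] (n : ℕ) (G : List ℕ → M) :
    ∑ c : Composition n, G c.blocks = ∑ l ∈ parts n, G l := by
  rw [parts, sum_image]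
  intro a _ b _ h
  exact Composition.ext h

theorem incLast_cons_cons (a b : ℕ) (l : List ℕ) :
    incLast (a :: b :: l) = a :: incLast (b :: l) := by
  simp [incLast, addBall]

theorem incLast_ne_nil : ∀ {l : List ℕ}, incLast l ≠ []
  | [] => by simp [incLast, addBall]
  | a :: l => by simp [incLast, addBall]

theorem decLast_incLast : ∀ l : List ℕ, (∀ a ∈ l, 0 < a) → l ≠ [] → decLast (incLast l) = l
  | [], _, h => (h rfl).elim
  | [a], h, _ => by
      have : 0 < a := h a (by simp)
      simp only [incLast, addBall]
      simp [decLast]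
      omega
  | a :: b :: l, h, _ => by
      have ih := decLast_incLast (b :: l) (fun y hy => h y (List.mem_cons_of_mem _ hy)) (by simp)
      rw [incLast_cons_cons]
      obtain ⟨u, v, huv⟩ := List.exists_cons_of_ne_nil (incLast_ne_nil (l := b :: l))
      rw [huv] at ih ⊢
      simp only [decLast, ih]

theorem decLast_append_one : ∀ l : List ℕ, decLast (l ++ [1]) = l
  | [] => by simp [decLast]
  | [a] => by simp [decLast]
  | a :: b :: l => by
      have ih := decLast_append_one (b :: l)
      simp only [List.cons_append, decLast] at ih ⊢
      rw [ih]

theorem eq_incLast_or_eq_append_one : ∀ l : List ℕ, (∀ a ∈ l, 0 < a) → 2 ≤ l.sum →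
    l = incLast (decLast l) ∨ l = decLast l ++ [1]
  | [], _, h => by simp at h
  | [a], _, h => by
      simp only [List.sum_cons, List.sum_nil] at h
      left
      have h1 : a ≠ 1 := by omega
      simp [decLast, h1, incLast, addBall]
      omega
  | [a, b], h, _ => by
      have : 0 < b := h b (by simp)
      by_cases hb : b = 1
      · right; simp [decLast, hb]
      · left; simp [decLast, hb, incLast, addBall]; omega
  | a :: b :: c :: l, h, _ => by
      have h' : ∀ y ∈ b :: c :: l, 0 < y := fun y hy => h y (List.mem_cons_of_mem _ hy)
      have hb : 0 < b := h b (by simp)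
      have hc : 0 < c := h c (by simp)
      have ih := eq_incLast_or_eq_append_one (b :: c :: l) h'
        (by simp only [List.sum_cons]; omega)
      simp only [decLast] at ih ⊢
      rw [incLast_cons_cons]
      rcases ih with ih | ih
      · left; rw [← ih]
      · right; simpa using ih

theorem decLast_mem_parts {n : ℕ} {l : List ℕ} (h : l ∈ parts (n + 1)) : decLast l ∈ parts n := by
  have h' := mem_parts.1 h
  have := decLast_sum l h'.1 (ne_nil_of_mem_parts h)
  exact mem_parts.2 ⟨decLast_pos l h'.1, by omega⟩

theorem addBall_mem_parts {n j : ℕ} {l : List ℕ} (h : l ∈ parts n) (hj : j ≤ l.length) :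
    addBall j l ∈ parts (n + 1) := by
  have h' := mem_parts.1 h
  unfold addBall
  split_ifs with h0
  · refine mem_parts.2 ⟨fun a ha => ?_, by simp [h'.2, add_comm]⟩
    rcases List.mem_cons.1 ha with rfl | ha
    · exact Nat.one_pos
    · exact h'.1 a ha
  · exact mem_parts.2 ⟨modify_pos _ _ h'.1, by rw [modify_sum _ _ (by omega), h'.2]⟩

theorem incLast_mem_parts {n : ℕ} {l : List ℕ} (h : l ∈ parts n) : incLast l ∈ parts (n + 1) :=
  addBall_mem_parts h le_rfl

theorem append_one_mem_parts {n : ℕ} {l : List ℕ} (h : l ∈ parts n) :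
    l ++ [1] ∈ parts (n + 1) := by
  have h' := mem_parts.1 h
  refine mem_parts.2 ⟨fun a ha => ?_, by simp [h'.2]⟩
  rcases List.mem_append.1 ha with ha | ha
  · exact h'.1 a ha
  · simp at ha; omega

theorem length_incLast {l : List ℕ} (h : l ≠ []) : (incLast l).length = l.length := by
  have := List.length_pos_iff.2 h
  rw [incLast, addBall, if_neg (by omega), List.length_modify]

/-- The removed ball was either in the last bin of `b` or alone in a bin of its own. Hence removal
is two-to-one, which drives the induction on the number of balls. -/
theorem filter_decLast_eq {n : ℕ} {b : List ℕ} (hb : b ∈ parts (n + 1)) :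
    {l ∈ parts (n + 2) | decLast l = b} = {incLast b, b ++ [1]} := by
  ext l
  have hb' := mem_parts.1 hb
  simp only [mem_filter, mem_insert, mem_singleton]
  constructor
  · rintro ⟨h, rfl⟩
    have h' := mem_parts.1 h
    exact eq_incLast_or_eq_append_one l h'.1 (by omega)
  · rintro (rfl | rfl)
    · exact ⟨incLast_mem_parts hb, decLast_incLast b hb'.1 (ne_nil_of_mem_parts hb)⟩
    · exact ⟨append_one_mem_parts hb, decLast_append_one b⟩

theorem sum_parts_succ {M : Type*} [AddCommMonoid M] (n : ℕ) (G : List ℕ → M) :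
    ∑ l ∈ parts (n + 2), G l = ∑ b ∈ parts (n + 1), (G (incLast b) + G (b ++ [1])) := by
  rw [← sum_fiberwise_of_maps_to (fun l hl => decLast_mem_parts hl)]
  refine sum_congr rfl fun b hb => ?_
  rw [filter_decLast_eq hb, sum_pair]
  intro h
  have := congrArg List.length h
  rw [length_incLast (ne_nil_of_mem_parts hb)] at this
  simp at this

theorem addBall_append_one {j : ℕ} {l : List ℕ} (hj : j ≤ l.length) :
    addBall j (l ++ [1]) = addBall j l ++ [1] := by
  unfold addBall
  split_ifs with h0
  · rfl
  · rw [List.modify_eq_take_cons_drop (by simp; omega),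
      List.modify_eq_take_cons_drop (by omega), List.take_append_of_le_length (by omega),
      List.drop_append_of_le_length (by omega)]
    simp [List.getElem_append_left (show j - 1 < l.length by omega)]

theorem addBall_incLast {j : ℕ} {l : List ℕ} (hl : l ≠ []) :
    addBall j (incLast l) = incLast (addBall j l) := by
  have hpos := List.length_pos_iff.2 hl
  rcases Nat.eq_zero_or_pos j with rfl | hj
  · obtain ⟨a, t, rfl⟩ := List.exists_cons_of_ne_nil hl
    simp [incLast, addBall]
  · simp only [incLast, addBall, if_neg hj.ne', if_neg hpos.ne', List.length_modify]
    by_cases h : j = l.length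
    · rw [h]
    · rw [List.modify_modify_ne _ _ _ (by omega)]

/-- The move `T_j` adds a ball to bin `j` and takes one from the last bin. -/
theorem moveBlocks_eq {j : ℕ} {l : List ℕ} (hpos : ∀ a ∈ l, 0 < a) (hl : l ≠ [])
    (hj : j ≤ l.length) : moveBlocks j l = decLast (addBall j l) := by
  unfold moveBlocks
  split_ifs with h0 h1
  · obtain ⟨a, t, rfl⟩ := List.exists_cons_of_ne_nil hl
    simp [h0, addBall, decLast]
  · rw [addBall, if_neg h0]
  · obtain rfl : j = l.length := by omega
    exact (decLast_incLast l hpos hl).symm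

theorem moveBlocks_eq_self {j : ℕ} {l : List ℕ} (hl : l ≠ []) (hj : l.length ≤ j) :
    moveBlocks j l = l := by
  have := List.length_pos_iff.2 hl
  rw [moveBlocks, if_neg (by omega), if_neg (by omega)]

theorem decLast_addBall_incLast {j n : ℕ} {b : List ℕ} (hb : b ∈ parts (n + 1))
    (hj : j ≤ b.length) : decLast (addBall j (incLast b)) = addBall j b := by
  have h := addBall_mem_parts hb hj
  rw [addBall_incLast (ne_nil_of_mem_parts hb),
    decLast_incLast _ (mem_parts.1 h).1 (ne_nil_of_mem_parts h)]

theorem decLast_addBall_append_one {j : ℕ} {b : List ℕ} (hj : j ≤ b.length) :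
    decLast (addBall j (b ++ [1])) = addBall j b := by
  rw [addBall_append_one hj, decLast_append_one]

theorem length_decLast_mem_Icc {n : ℕ} {d : List ℕ} (hd : d ∈ parts (n + 2)) :
    (decLast d).length ∈ Icc 1 (n + 1) :=
  mem_Icc.2 ⟨length_pos_of_mem_parts (decLast_mem_parts hd),
    length_le_of_mem_parts (decLast_mem_parts hd)⟩

/-- `x_0 + ⋯ + x_k`. -/
def partialSum {R : Type*} [CommRing R] (x : ℕ → R) (k : ℕ) : R := ∑ i ∈ range (k + 1), x i

/-! ### Recursion for the stationary distribution over a field. -/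

section Chain

variable {K : Type*} [Field K]

/-- The stationarity of `p` for the chain on the compositions of `n + 1`, tested on functions. -/
def Balanced (x : ℕ → K) (n : ℕ) (p : List ℕ → K) : Prop :=
  ∀ g : List ℕ → K,
    ∑ c ∈ parts (n + 1), p c * ∑ j ∈ range (n + 1), x j * (g (moveBlocks j c) - g c) = 0

/-- The law of the first `n` balls when `p` is the law of the first `n + 1` balls. -/
def marginal (p : List ℕ → K) (b : List ℕ) : K := p (incLast b) + p (b ++ [1])

/-- The total rate of the transitions to `d` obtained by inserting a ball into a composition of
`n + 1` with distribution `q`. -/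
noncomputable def inflow {R : Type*} [CommRing R] (x : ℕ → R) (n : ℕ) (q : List ℕ → R)
    (d : List ℕ) : R :=
  ∑ b ∈ parts (n + 1), ∑ j ∈ range (b.length + 1), if addBall j b = d then x j * q b else 0

/-- Moves with `j ≥ c.length` fix `c` and contribute zero. Keeping the null term `j = c.length` lets
one formula cover all remaining moves. -/
theorem sum_moveBlocks (x : ℕ → K) {n : ℕ} {c : List ℕ} (hc : c ∈ parts (n + 1)) {m : ℕ}
    (hm : c.length ≤ m) (g : List ℕ → K) :
    ∑ j ∈ range m, x j * (g (moveBlocks j c) - g c) =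
      ∑ j ∈ range (c.length + 1), x j * (g (decLast (addBall j c)) - g c) := by
  have hne := ne_nil_of_mem_parts hc
  have hpos := (mem_parts.1 hc).1
  rw [sum_range_succ, ← moveBlocks_eq hpos hne le_rfl, moveBlocks_eq_self hne le_rfl, sub_self,
    mul_zero, add_zero, ← sum_subset (range_subset_range.2 hm)]
  · refine sum_congr rfl fun j hj => ?_
    rw [moveBlocks_eq hpos hne (mem_range.1 hj).le]
  · intro j _ hj
    rw [moveBlocks_eq_self hne (by simpa using hj), sub_self, mul_zero]

theorem sum_moveBlocks_incLast (x : ℕ → K) {n : ℕ} {b : List ℕ} (hb : b ∈ parts (n + 1))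
    (g : List ℕ → K) :
    ∑ j ∈ range (n + 2), x j * (g (moveBlocks j (incLast b)) - g (incLast b)) =
      ∑ j ∈ range (b.length + 1), x j * (g (addBall j b) - g (incLast b)) := by
  have hc := incLast_mem_parts hb
  rw [sum_moveBlocks x hc (length_le_of_mem_parts hc), length_incLast (ne_nil_of_mem_parts hb)]
  refine sum_congr rfl fun j hj => ?_
  rw [decLast_addBall_incLast hb (Nat.lt_succ_iff.1 (mem_range.1 hj))]

theorem sum_moveBlocks_append_one (x : ℕ → K) {n : ℕ} {b : List ℕ} (hb : b ∈ parts (n + 1))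
    (g : List ℕ → K) :
    ∑ j ∈ range (n + 2), x j * (g (moveBlocks j (b ++ [1])) - g (b ++ [1])) =
      ∑ j ∈ range (b.length + 1), x j * (g (addBall j b) - g (b ++ [1])) := by
  have hc := append_one_mem_parts hb
  have hne := ne_nil_of_mem_parts hc
  -- The top index is the length of `b ++ [1]`, a null move; dropping it leaves the same index range
  -- as for `incLast b`.
  rw [sum_moveBlocks x hc (length_le_of_mem_parts hc), sum_range_succ,
    ← moveBlocks_eq (mem_parts.1 hc).1 hne le_rfl, moveBlocks_eq_self hne le_rfl, sub_self,
    mul_zero, add_zero, List.length_append, List.length_singleton]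
  refine sum_congr rfl fun j hj => ?_
  rw [decLast_addBall_append_one (Nat.lt_succ_iff.1 (mem_range.1 hj))]

/-- Both preimages of `b` under `decLast` have the same targets at the same rates, so the gain term
sees `p` only through its marginal. -/
theorem sum_mul_sum_moveBlocks (x : ℕ → K) (n : ℕ) (p g : List ℕ → K) :
    ∑ c ∈ parts (n + 2), p c * ∑ j ∈ range (n + 2), x j * (g (moveBlocks j c) - g c) =
      ∑ b ∈ parts (n + 1), marginal p b * ∑ j ∈ range (b.length + 1), x j * g (addBall j b) -
      ∑ d ∈ parts (n + 2), partialSum x (decLast d).length * p d * g d := by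
  rw [sum_parts_succ, sum_parts_succ, ← sum_sub_distrib]
  refine sum_congr rfl fun b hb => ?_
  rw [sum_moveBlocks_incLast x hb, sum_moveBlocks_append_one x hb, decLast_append_one,
    decLast_incLast b (mem_parts.1 hb).1 (ne_nil_of_mem_parts hb)]
  simp only [mul_sub, sum_sub_distrib, ← sum_mul, marginal, partialSum]
  ring

theorem sum_mul_inflow {R : Type*} [CommRing R] (x : ℕ → R) (n : ℕ) (q g : List ℕ → R) :
    ∑ d ∈ parts (n + 2), inflow x n q d * g d =
      ∑ b ∈ parts (n + 1), q b * ∑ j ∈ range (b.length + 1), x j * g (addBall j b) := by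
  simp only [inflow, sum_mul, mul_sum]
  rw [sum_comm]
  refine sum_congr rfl fun b hb => ?_
  rw [sum_comm]
  refine sum_congr rfl fun j hj => ?_
  have := addBall_mem_parts hb (Nat.lt_succ_iff.1 (mem_range.1 hj))
  simp only [ite_mul, zero_mul, sum_ite_eq, this, if_true]
  ring

theorem balanced_succ_iff (x : ℕ → K) (n : ℕ) (p : List ℕ → K) :
    Balanced x (n + 1) p ↔ ∀ d ∈ parts (n + 2),
      partialSum x (decLast d).length * p d = inflow x n (marginal p) d := by
  constructor
  · intro h d hd
    have := h fun c => if c = d then 1 else 0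
    rw [sum_mul_sum_moveBlocks x n p fun c => if c = d then 1 else 0,
      ← sum_mul_inflow x n _ fun c => if c = d then 1 else 0, sub_eq_zero] at this
    simpa [hd] using this.symm
  · intro h g
    rw [sum_mul_sum_moveBlocks, ← sum_mul_inflow, sub_eq_zero]
    exact sum_congr rfl fun d hd => by rw [h d hd]

theorem Balanced.marginal {x : ℕ → K} {n : ℕ} {p : List ℕ → K} (h : Balanced x (n + 1) p) :
    Balanced x n (marginal p) := by
  intro g
  -- Functions of `decLast c` test the lumped chain, in which the last ball is forgotten.
  have := h fun c => g (decLast c)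
  rw [sum_mul_sum_moveBlocks x n p fun c => g (decLast c), sum_parts_succ, ← sum_sub_distrib] at this
  rw [← this]
  refine sum_congr rfl fun b hb => ?_
  rw [sum_moveBlocks x hb (length_le_of_mem_parts hb), decLast_append_one,
    decLast_incLast b (mem_parts.1 hb).1 (ne_nil_of_mem_parts hb)]
  simp only [mul_sub, sum_sub_distrib, ← sum_mul, HilbertGalton.marginal, partialSum]
  ring

/-- The stationary probabilities of the compositions of `n + 1`. -/
noncomputable def weight (x : ℕ → K) : ℕ → List ℕ → K
  | 0, _ => 1
  | n + 1, d => inflow x n (weight x n) d / partialSum x (decLast d).length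

theorem inflow_congr {R : Type*} [CommRing R] (x : ℕ → R) {n : ℕ} {q q' : List ℕ → R}
    (h : ∀ b ∈ parts (n + 1), q b = q' b) (d : List ℕ) : inflow x n q d = inflow x n q' d :=
  sum_congr rfl fun b hb => by rw [h b hb]

theorem balanced_zero (x : ℕ → K) (p : List ℕ → K) : Balanced x 0 p := by
  intro g
  simp [parts_one, moveBlocks, decLast]

/-- The left side is the inflow into the fibre of `decLast` over `b`. After lumping it is the inflow
into `b` for the smaller chain, self-loops included, which balances the outflow. This makes the
recursive weights consistent under taking marginals. -/
theorem inflow_incLast_add_inflow_append_one {x : ℕ → K} {n : ℕ} {q : List ℕ → K}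
    (h : Balanced x n q) {b : List ℕ} (hb : b ∈ parts (n + 1)) :
    inflow x n q (incLast b) + inflow x n q (b ++ [1]) = partialSum x b.length * q b := by
  have h1 := sum_mul_inflow x n q fun c => if decLast c = b then 1 else 0
  have h2 := h fun c => if c = b then 1 else 0
  have h3 : ∑ c ∈ parts (n + 1), q c *
      ∑ j ∈ range (n + 1), x j *
        ((if moveBlocks j c = b then 1 else 0) - if c = b then 1 else 0) =
      ∑ c ∈ parts (n + 1), q c * ∑ j ∈ range (c.length + 1), x j *
        (if decLast (addBall j c) = b then 1 else 0) -
      ∑ c ∈ parts (n + 1), if c = b then partialSum x c.length * q c else 0 := by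
    rw [← sum_sub_distrib]
    refine sum_congr rfl fun c hc => ?_
    rw [sum_moveBlocks x hc (length_le_of_mem_parts hc) fun c => if c = b then 1 else 0]
    simp only [mul_sub, sum_sub_distrib, ← sum_mul, partialSum]
    split_ifs <;> ring
  rw [h3, ← h1, sub_eq_zero, sum_ite_eq' (parts (n + 1)) b, if_pos hb] at h2
  rw [← h2]
  simp only [mul_ite, mul_one, mul_zero]
  rw [← sum_filter, filter_decLast_eq hb, sum_pair]
  intro h
  have := congrArg List.length h
  rw [length_incLast (ne_nil_of_mem_parts hb)] at this
  simp at this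

theorem marginal_weight_of_balanced {x : ℕ → K} {n : ℕ}
    (hx : ∀ k ∈ Icc 1 (n + 1), partialSum x k ≠ 0) (h : Balanced x n (weight x n))
    {b : List ℕ} (hb : b ∈ parts (n + 1)) : marginal (weight x (n + 1)) b = weight x n b := by
  have hk := hx b.length
    (mem_Icc.2 ⟨length_pos_of_mem_parts hb, length_le_of_mem_parts hb⟩)
  rw [marginal, weight, weight, decLast_append_one,
    decLast_incLast b (mem_parts.1 hb).1 (ne_nil_of_mem_parts hb), ← add_div,
    inflow_incLast_add_inflow_append_one h hb, mul_div_cancel_left₀ _ hk]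

theorem balanced_weight {x : ℕ → K} : ∀ {n : ℕ}, (∀ k ∈ Icc 1 n, partialSum x k ≠ 0) →
    Balanced x n (weight x n)
  | 0, _ => balanced_zero _ _
  | n + 1, hx => by
    have ih : Balanced x n (weight x n) := balanced_weight fun k hk =>
      hx k (Icc_subset_Icc_right (Nat.le_succ n) hk)
    rw [balanced_succ_iff]
    intro d hd
    rw [inflow_congr x (fun b hb => marginal_weight_of_balanced hx ih hb), weight,
      mul_div_cancel₀ _ (hx _ (length_decLast_mem_Icc hd))]

theorem sum_weight {x : ℕ → K} : ∀ {n : ℕ}, (∀ k ∈ Icc 1 n, partialSum x k ≠ 0) →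
    ∑ c ∈ parts (n + 1), weight x n c = 1
  | 0, _ => by simp [parts_one, weight]
  | n + 1, hx => by
    have hx' : ∀ k ∈ Icc 1 n, partialSum x k ≠ 0 := fun k hk =>
      hx k (Icc_subset_Icc_right (Nat.le_succ n) hk)
    rw [sum_parts_succ, ← sum_weight hx']
    exact sum_congr rfl fun b hb => marginal_weight_of_balanced hx (balanced_weight hx') hb

/-- By induction the marginal is determined, and the local balance equation then determines `p`. -/
theorem eq_weight_of_balanced {x : ℕ → K} : ∀ {n : ℕ} {p : List ℕ → K},
    (∀ k ∈ Icc 1 n, partialSum x k ≠ 0) → Balanced x n p → ∑ c ∈ parts (n + 1), p c = 1 →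
    ∀ c ∈ parts (n + 1), p c = weight x n c
  | 0, p, _, _, h => by simpa [parts_one, weight] using h
  | n + 1, p, hx, hp, h => by
    have ih := eq_weight_of_balanced
      (fun k hk => hx k (Icc_subset_Icc_right (Nat.le_succ n) hk)) hp.marginal
      (by rw [sum_parts_succ] at h; exact h)
    intro d hd
    have := (balanced_succ_iff x n p).1 hp d hd
    rw [inflow_congr x ih] at this
    rw [weight, ← this, mul_div_cancel_left₀ _ (hx _ (length_decLast_mem_Icc hd))]

theorem weight_nonneg {x : ℕ → ℝ} (hx : ∀ i, 0 ≤ x i) : ∀ (n : ℕ) (d : List ℕ), 0 ≤ weight x n d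
  | 0, _ => zero_le_one
  | n + 1, d => by
    refine div_nonneg (sum_nonneg fun b _ => sum_nonneg fun j _ => ?_) (sum_nonneg fun i _ => hx i)
    split_ifs
    · exact mul_nonneg (hx j) (weight_nonneg hx n b)
    · exact le_rfl

end Chain

/-! ### A common denominator valid in any commutative ring. -/

section Numerators

variable {R : Type*} [CommRing R]

/-- The common denominator `∏ y_k ^ (n + 1 - k)` of the stationary probabilities of the compositions
of `n + 1`. -/
def denom (x : ℕ → R) (n : ℕ) : R := ∏ k ∈ Icc 1 n, partialSum x k ^ (n + 1 - k)

/-- The numerators of the stationary probabilities over the common denominator `denom x n`. -/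
noncomputable def numer (x : ℕ → R) : ℕ → List ℕ → R
  | 0, _ => 1
  | n + 1, d => inflow x n (numer x n) d *
      -- The erased factor is the one by which `weight` divides at this step.
      ∏ k ∈ (Icc 1 (n + 1)).erase (decLast d).length, partialSum x k

theorem denom_succ (x : ℕ → R) (n : ℕ) :
    denom x (n + 1) = denom x n * ∏ k ∈ Icc 1 (n + 1), partialSum x k := by
  rw [denom, denom, prod_Icc_succ_top (by omega), prod_Icc_succ_top (by omega), ← mul_assoc,
    ← prod_mul_distrib]
  congr 1
  · refine prod_congr rfl fun k hk => ?_
    rw [← pow_succ]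
    have := (mem_Icc.1 hk).2
    congr 1
    omega
  · simp

theorem map_partialSum {A : Type*} [CommRing A] (φ : R →+* A) (x : ℕ → R) (k : ℕ) :
    φ (partialSum x k) = partialSum (φ ∘ x) k := by
  simp [partialSum]

theorem map_denom {A : Type*} [CommRing A] (φ : R →+* A) (x : ℕ → R) (n : ℕ) :
    φ (denom x n) = denom (φ ∘ x) n := by
  simp [denom, map_partialSum]

theorem map_inflow {A : Type*} [CommRing A] (φ : R →+* A) (x : ℕ → R) (n : ℕ) (q : List ℕ → R)
    (d : List ℕ) : φ (inflow x n q d) = inflow (φ ∘ x) n (φ ∘ q) d := by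
  simp only [inflow, map_sum]
  refine sum_congr rfl fun b _ => sum_congr rfl fun j _ => ?_
  split_ifs <;> simp

theorem map_numer {A : Type*} [CommRing A] (φ : R →+* A) (x : ℕ → R) :
    ∀ (n : ℕ) (d : List ℕ), φ (numer x n d) = numer (φ ∘ x) n d
  | 0, _ => map_one φ
  | n + 1, d => by
    rw [numer, numer, map_mul, map_inflow, map_prod,
      show φ ∘ numer x n = numer (φ ∘ x) n from funext (map_numer φ x n)]
    simp only [map_partialSum]

theorem inflow_mul_right (x : ℕ → R) (n : ℕ) (q : List ℕ → R) (a : R) (d : List ℕ) :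
    inflow x n q d * a = inflow x n (fun b => q b * a) d := by
  simp only [inflow, sum_mul, ite_mul, zero_mul, mul_assoc]

theorem weight_mul_denom {K : Type*} [Field K] {x : ℕ → K} : ∀ {n : ℕ},
    (∀ k ∈ Icc 1 n, partialSum x k ≠ 0) → ∀ d ∈ parts (n + 1),
      weight x n d * denom x n = numer x n d
  | 0, _, _, _ => by simp [weight, denom, numer]
  | n + 1, hx, d, hd => by
    have ih := weight_mul_denom fun k hk => hx k (Icc_subset_Icc_right (Nat.le_succ n) hk)
    have hk := length_decLast_mem_Icc hd
    rw [weight, numer, denom_succ, ← mul_prod_erase _ _ hk, ← inflow_congr x ih,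
      ← inflow_mul_right]
    field_simp [hx _ hk]

theorem denom_ne_zero {K : Type*} [Field K] {x : ℕ → K} {n : ℕ}
    (hx : ∀ k ∈ Icc 1 n, partialSum x k ≠ 0) : denom x n ≠ 0 :=
  prod_ne_zero_iff.2 fun k hk => pow_ne_zero _ (hx k hk)

end Numerators

/-! ### Explicit probabilities of hooks. -/

section Hooks

variable {K : Type*} [Field K]

theorem modify_ne_replicate {l : List ℕ} (hl : ∀ a ∈ l, 0 < a) {i : ℕ} (hi : i < l.length)
    (k : ℕ) : l.modify i (· + 1) ≠ List.replicate k 1 := by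
  intro h
  have h1 : l[i] + 1 ∈ l.modify i (· + 1) := by
    have h2 := List.getElem_mem (l := l.modify i (· + 1)) (n := i) (by simpa using hi)
    rwa [List.getElem_modify_eq] at h2
  rw [h] at h1
  have := List.eq_of_mem_replicate h1
  have := hl _ (List.getElem_mem hi)
  omega

theorem inflow_eq_single {R : Type*} [CommRing R] (x : ℕ → R) {n : ℕ} (q : List ℕ → R)
    {b : List ℕ} {j : ℕ}
    (hb : b ∈ parts (n + 1)) (hj : j ≤ b.length)
    (h : ∀ b' ∈ parts (n + 1), ∀ j' ≤ b'.length, addBall j' b' = addBall j b → b' = b ∧ j' = j) :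
    inflow x n q (addBall j b) = x j * q b := by
  rw [inflow, sum_eq_single_of_mem b hb, sum_eq_single_of_mem j (mem_range.2 (by omega)),
    if_pos rfl]
  · intro j' hj' hne
    exact if_neg fun h' => hne (h b hb j' (Nat.lt_succ_iff.1 (mem_range.1 hj')) h').2
  · intro b' hb' hne
    exact sum_eq_zero fun j' hj' =>
      if_neg fun h' => hne (h b' hb' j' (Nat.lt_succ_iff.1 (mem_range.1 hj')) h').1

theorem hook_mem_parts (a k : ℕ) : (a + 1) :: List.replicate k 1 ∈ parts (k + a + 1) := by
  refine mem_parts.2 ⟨fun b hb => ?_, by simp; omega⟩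
  rcases List.mem_cons.1 hb with rfl | hb
  · omega
  · rw [List.eq_of_mem_replicate hb]; exact Nat.one_pos

/-- The hook has a unique predecessor: a new bin would make the first part 1, and a ball added
beyond the first bin would leave a part of size at least 2 there. -/
theorem inflow_hook (x : ℕ → K) (q : List ℕ → K) (a k : ℕ) :
    inflow x (k + a) q ((a + 2) :: List.replicate k 1) =
      x 1 * q ((a + 1) :: List.replicate k 1) := by
  have h0 : (a + 2) :: List.replicate k 1 = addBall 1 ((a + 1) :: List.replicate k 1) := by
    simp [addBall]
  rw [h0, inflow_eq_single x q (hook_mem_parts a k) (by simp)]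
  rw [← h0]
  intro b hb j hj h
  obtain ⟨c, t, rfl⟩ := List.exists_cons_of_ne_nil (ne_nil_of_mem_parts hb)
  have hpos := (mem_parts.1 hb).1
  match j, hj, h with
  | 0, _, h => simp [addBall] at h
  | 1, _, h => simp [addBall] at h; simp [h.1, h.2]
  | j + 2, hj, h =>
    simp only [addBall, if_neg (show j + 2 ≠ 0 by omega), List.modify_succ_cons,
      show j + 2 - 1 = j + 1 by omega, List.cons.injEq] at h
    exact absurd h.2 (modify_ne_replicate (fun y hy => hpos y (List.mem_cons_of_mem _ hy))
      (by simpa using hj) k)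

theorem inflow_replicate (x : ℕ → K) (q : List ℕ → K) (k : ℕ) :
    inflow x k q (List.replicate (k + 2) 1) = x 0 * q (List.replicate (k + 1) 1) := by
  have h0 : List.replicate (k + 2) 1 = addBall 0 (List.replicate (k + 1) 1) := by
    simp [addBall, List.replicate_succ]
  have hmem : List.replicate (k + 1) 1 ∈ parts (k + 1) := by
    simpa [List.replicate_succ] using hook_mem_parts 0 k
  rw [h0, inflow_eq_single x q hmem (by simp)]
  rw [← h0]
  intro b hb j hj h
  by_cases hj0 : j = 0
  · subst hj0
    rw [addBall, if_pos rfl, List.replicate_succ, List.cons.injEq] at h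
    exact ⟨h.2, rfl⟩
  · rw [addBall, if_neg hj0] at h
    exact absurd h (modify_ne_replicate (mem_parts.1 hb).1 (by omega) _)

theorem decLast_replicate (k : ℕ) : decLast (List.replicate (k + 1) 1) = List.replicate k 1 := by
  rw [List.replicate_succ', decLast_append_one]

theorem weight_replicate (x : ℕ → K) : ∀ k : ℕ,
    weight x k (List.replicate (k + 1) 1) = ∏ i ∈ Icc 1 k, (x 0 / partialSum x i)
  | 0 => by simp [weight]
  | k + 1 => by
    rw [weight, inflow_replicate, weight_replicate x k, decLast_replicate, List.length_replicate,
      prod_Icc_succ_top (by omega)]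
    ring

theorem weight_hook (x : ℕ → K) (k : ℕ) : ∀ a : ℕ,
    weight x (k + 1 + a) ((a + 1) :: List.replicate (k + 1) 1) =
      (x 1 / partialSum x (k + 1)) ^ a * ∏ i ∈ Icc 1 (k + 1), (x 0 / partialSum x i)
  | 0 => by simpa [List.replicate_succ] using weight_replicate x (k + 1)
  | a + 1 => by
    have h : decLast ((a + 2) :: List.replicate (k + 1) 1) = (a + 2) :: List.replicate k 1 := by
      rw [List.replicate_succ', ← List.cons_append, decLast_append_one]
    rw [← add_assoc, weight, inflow_hook, weight_hook x k a, h, List.length_cons,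
      List.length_replicate, pow_succ]
    ring

theorem weight_hook_mul (x : ℕ → K) (k a : ℕ) (hx : ∀ i ∈ Icc 1 (k + 1), partialSum x i ≠ 0) :
    weight x (k + 1 + a) ((a + 1) :: List.replicate (k + 1) 1) *
      (partialSum x (k + 1) ^ (a + 1) * ∏ i ∈ Icc 1 k, partialSum x i) =
      x 1 ^ a * x 0 ^ (k + 1) := by
  have h1 := hx (k + 1) (by simp)
  have h2 : ∏ i ∈ Icc 1 k, partialSum x i ≠ 0 :=
    prod_ne_zero_iff.2 fun i hi => hx i (Icc_subset_Icc_right (Nat.le_succ k) hi)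
  rw [weight_hook, prod_Icc_succ_top (by omega), prod_div_distrib, prod_const, Nat.card_Icc,
    Nat.add_sub_cancel, div_pow]
  field_simp
  ring

end Hooks

/-! ### Arithmetic of the linear forms `y_k`. -/

/-- A finite sequence, continued by zeros. -/
def extendZero {n : ℕ} {A : Type*} [Zero A] (x : Fin n → A) (j : ℕ) : A :=
  if h : j < n then x ⟨j, h⟩ else 0

theorem extendZero_val {n : ℕ} {A : Type*} [Zero A] (x : Fin n → A) (j : Fin n) :
    extendZero x j = x j := by
  simp [extendZero]

theorem extendZero_of_lt {n : ℕ} {A : Type*} [Zero A] (x : Fin n → A) {j : ℕ} (hj : j < n) :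
    extendZero x j = x ⟨j, hj⟩ := dif_pos hj

theorem map_comp_extendZero {n : ℕ} {A B : Type*} [CommRing A] [CommRing B] (φ : A →+* B)
    (x : Fin n → A) : φ ∘ extendZero x = extendZero (φ ∘ x) := by
  ext j
  simp only [extendZero, Function.comp]
  split_ifs <;> simp

theorem y_eq_partialSum {n k : ℕ} (hk : k < n) :
    y n k = partialSum (extendZero (MvPolynomial.X : Fin n → MvPolynomial (Fin n) ℤ)) k := by
  have h : (range n).filter (fun i => i ≤ k) = range (k + 1) := by
    ext i
    simp only [mem_filter, mem_range]
    omega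
  rw [y, partialSum, ← h, sum_filter, sum_filter, sum_range]
  simp only [extendZero_val]

theorem aeval_comp_extendZero {n : ℕ} {A : Type*} [CommRing A] (x : Fin n → A) :
    (MvPolynomial.aeval x : MvPolynomial (Fin n) ℤ →ₐ[ℤ] A).toRingHom ∘
      extendZero MvPolynomial.X = extendZero x := by
  rw [map_comp_extendZero]
  congr 1
  ext i
  simp

theorem aeval_y {n k : ℕ} (hk : k < n) {A : Type*} [CommRing A] (x : Fin n → A) :
    MvPolynomial.aeval x (y n k) = partialSum (extendZero x) k := by
  rw [y_eq_partialSum hk, ← aeval_comp_extendZero x, ← map_partialSum]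
  rfl

/-- A nonzero linear form with a coefficient 1 has unit content, hence is irreducible; factorization
is unique. -/
theorem prime_y {n k : ℕ} (hkn : k < n) : Prime (y n k) := by
  have key : MvPolynomial.sumSMulX (Finsupp.equivFunOnFinite.symm
      fun i : Fin n => if i.val ≤ k then (1 : ℤ) else 0) = y n k := by
    rw [MvPolynomial.sumSMulX, Finsupp.linearCombination_apply, Finsupp.sum_fintype _ _ (by simp),
      y, sum_filter]
    simp
  rw [← key]
  refine Irreducible.prime (MvPolynomial.irreducible_sumSMulX _ ⟨⟨0, by omega⟩, ?_⟩ ?_)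
  · simp
  · intro r hr
    have := hr ⟨0, by omega⟩
    exact isUnit_of_dvd_one (by simpa using this)

theorem not_y_dvd_y {n j k : ℕ} (hj : 1 ≤ j) (hjn : j < n) (hkn : k < n) (hjk : j ≠ k) :
    ¬ y n j ∣ y n k := by
  -- At this point `y_j` vanishes and every other `y_i` equals 1; `j ≥ 1` keeps the entries at 0 and
  -- `j` apart.
  let x : ℕ → ℤ := fun i => if i = 0 then 1 else if i = j then -1 else if i = j + 1 then 1 else 0
  have hx : ∀ i, partialSum x i = if i = j then 0 else 1 := by
    intro i
    induction i with
    | zero => rw [if_neg (by omega)]; simp [partialSum, x]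
    | succ i ih =>
      rw [partialSum, sum_range_succ, ← partialSum, ih]
      simp only [x]
      split_ifs <;> first | contradiction | omega
  have hext : ∀ i < n, partialSum (extendZero fun i : Fin n => x i) i = partialSum x i := by
    intro i hi
    refine sum_congr rfl fun l hl => extendZero_of_lt _ ?_
    have := mem_range.1 hl
    omega
  intro h
  have := map_dvd (MvPolynomial.aeval fun i : Fin n => x i) h
  rw [aeval_y hjn, aeval_y hkn, hext j hjn, hext k hkn, hx, hx, if_pos rfl, if_neg hjk.symm] at this
  simp at this

theorem not_y_dvd_X {n k : ℕ} (hk : 1 ≤ k) (hkn : k < n) {i : Fin n} (hi : i.val ≤ 1) :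
    ¬ y n k ∣ MvPolynomial.X i := by
  -- Every `y_k` with `k ≥ 1` vanishes here, while `x_0` and `x_1` are `-1` and `1`.
  let x : ℕ → ℤ := fun i => if i = 0 then -1 else if i = 1 then 1 else 0
  have hx : ∀ i, partialSum x (i + 1) = 0 := by
    intro i
    induction i with
    | zero => simp [partialSum, sum_range_succ, x]
    | succ i ih =>
      rw [partialSum, sum_range_succ, ← partialSum, ih]
      simp [x]
  intro h
  have := map_dvd (MvPolynomial.aeval fun i : Fin n => x i) h
  obtain ⟨l, rfl⟩ : ∃ l, k = l + 1 := ⟨k - 1, by omega⟩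
  have hext : partialSum (extendZero fun i : Fin n => x i) (l + 1) = partialSum x (l + 1) := by
    refine sum_congr rfl fun l hl => extendZero_of_lt _ ?_
    have := mem_range.1 hl
    omega
  rw [aeval_y hkn, hext, hx, MvPolynomial.aeval_X, zero_dvd_iff] at this
  simp only [x] at this
  split_ifs at this <;> omega

/-! ### From the generator to the recursion. -/

theorem partialSum_pos {n : ℕ} {x : Fin (n + 1) → ℝ} (hx : Admissible x) (k : ℕ) :
    0 < partialSum (extendZero x) k := by
  refine sum_pos' (fun i _ => ?_) ⟨0, by simp, ?_⟩
  · unfold extendZero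
    split_ifs
    exacts [hx.1 _, le_rfl]
  · rw [extendZero_of_lt x n.succ_pos]
    exact hx.2 _ zero_le_one

theorem sum_mul_sum_moveBlocks_eq_vecMul {n : ℕ} (x : Fin n → ℝ) (p g : List ℕ → ℝ) :
    ∑ c ∈ parts n, p c * ∑ j ∈ range n, extendZero x j * (g (moveBlocks j c) - g c) =
      ∑ d : Composition n, Matrix.vecMul (fun c => p c.blocks) (generator x) d * g d.blocks := by
  simp only [← sum_blocks, Matrix.vecMul, dotProduct, sum_mul, generator]
  rw [sum_comm]
  refine sum_congr rfl fun c _ => ?_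
  simp only [mul_assoc, ← mul_sum]
  congr 1
  simp only [sub_mul, sum_sub_distrib, mul_sub, sum_mul, ite_mul, zero_mul, sum_ite_eq, mem_univ,
    if_true]
  rw [sum_comm]
  simp only [sum_ite_eq, mem_univ, if_true, sum_range, extendZero_val]
  rfl

theorem isStationary_iff {n : ℕ} {x : Fin (n + 1) → ℝ} (hx : Admissible x)
    (π : Composition (n + 1) → ℝ) :
    IsStationary x π ↔ ∀ c, π c = weight (extendZero x) n c.blocks := by
  have hy : ∀ k ∈ Icc 1 n, partialSum (extendZero x) k ≠ 0 := fun k _ => (partialSum_pos hx k).ne'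
  constructor
  · intro h
    have hinj : Function.Injective (Composition.blocks (n := n + 1)) := fun a b => Composition.ext
    obtain ⟨p, rfl⟩ : ∃ p : List ℕ → ℝ, π = fun c => p c.blocks :=
      ⟨Function.extend Composition.blocks π 0, funext fun c => (hinj.extend_apply π 0 c).symm⟩
    intro c
    refine eq_weight_of_balanced hy ?_ ?_ _ (mem_parts.2 ⟨fun a ha => c.blocks_pos ha, c.blocks_sum⟩)
    · intro g
      rw [sum_mul_sum_moveBlocks_eq_vecMul, h.balance]
      simp
    · rw [← sum_blocks]
      exact h.sum_eq_one
  · intro h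
    obtain rfl : π = fun c => weight (extendZero x) n c.blocks := funext h
    refine ⟨fun c => weight_nonneg (fun i => ?_) _ _, ?_, ?_⟩
    · unfold extendZero
      split_ifs
      exacts [hx.1 _, le_rfl]
    · rw [sum_blocks (n + 1) (weight (extendZero x) n), sum_weight hy]
    · ext d
      have := balanced_weight hy fun l => if l = d.blocks then 1 else 0
      rw [sum_mul_sum_moveBlocks_eq_vecMul x (weight (extendZero x) n) fun l =>
        if l = d.blocks then 1 else 0] at this
      simpa [← Composition.ext_iff] using this

/-! ### Lowest terms, values and uniqueness of the rational functions. -/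

/-- The stationary probabilities as rational functions. -/
noncomputable def ratWeight (n : ℕ) (c : Composition (n + 1)) : RatFun (n + 1) :=
  weight (algebraMap (MvPolynomial (Fin (n + 1)) ℤ) (RatFun (n + 1)) ∘ extendZero MvPolynomial.X)
    n c.blocks

theorem algebraMap_num {n : ℕ} (r : RatFun n) :
    algebraMap (MvPolynomial (Fin n) ℤ) (RatFun n) (num r) =
      r * algebraMap (MvPolynomial (Fin n) ℤ) (RatFun n) (den r) :=
  (IsFractionRing.num_mul_den_eq_num_iff_eq'.2 rfl).symm

theorem num_mul_eq {n : ℕ} {r : RatFun n} {a b : MvPolynomial (Fin n) ℤ}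
    (h : r * algebraMap _ (RatFun n) a = algebraMap _ (RatFun n) b) : num r * a = b * den r := by
  apply IsFractionRing.injective (MvPolynomial (Fin n) ℤ) (RatFun n)
  rw [map_mul, map_mul, algebraMap_num, ← h]
  ring

theorem den_dvd {n : ℕ} {r : RatFun n} {a b : MvPolynomial (Fin n) ℤ}
    (h : r * algebraMap _ (RatFun n) a = algebraMap _ (RatFun n) b) : den r ∣ a := by
  have h1 : IsRelPrime (num r) (den r) := IsFractionRing.num_den_reduced _ r
  exact h1.symm.dvd_of_dvd_mul_left ⟨b, by rw [num_mul_eq h, mul_comm]⟩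

theorem partialSum_algebraMap_ne_zero {n : ℕ} : ∀ k ∈ Icc 1 n,
    partialSum (algebraMap (MvPolynomial (Fin (n + 1)) ℤ) (RatFun (n + 1)) ∘
      extendZero MvPolynomial.X) k ≠ 0 := by
  intro k hk
  obtain ⟨h1, h2⟩ := mem_Icc.1 hk
  rw [← map_partialSum, ← y_eq_partialSum (by omega), map_ne_zero_iff _
    (IsFractionRing.injective (MvPolynomial (Fin (n + 1)) ℤ) (RatFun (n + 1)))]
  exact (prime_y (by omega)).ne_zero

theorem ratWeight_mul_denom {n : ℕ} (c : Composition (n + 1)) :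
    ratWeight n c * algebraMap (MvPolynomial (Fin (n + 1)) ℤ) (RatFun (n + 1))
      (denom (extendZero MvPolynomial.X) n) =
      algebraMap (MvPolynomial (Fin (n + 1)) ℤ) (RatFun (n + 1))
        (numer (extendZero MvPolynomial.X) n c.blocks) := by
  rw [map_denom, map_numer]
  exact weight_mul_denom partialSum_algebraMap_ne_zero _
    (mem_parts.2 ⟨fun a ha => c.blocks_pos ha, c.blocks_sum⟩)

/-- The reduced denominator divides `denom`, a product of sums that are positive at admissible
rates, so evaluation commutes with the recursion. -/
theorem hasValueAt_ratWeight_iff {n : ℕ} {x : Fin (n + 1) → ℝ} (hx : Admissible x)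
    (c : Composition (n + 1)) (v : ℝ) :
    HasValueAt (ratWeight n c) x v ↔ v = weight (extendZero x) n c.blocks := by
  have hy : ∀ k ∈ Icc 1 n, partialSum (extendZero x) k ≠ 0 := fun k _ => (partialSum_pos hx k).ne'
  have hD : MvPolynomial.aeval x (denom (extendZero (MvPolynomial.X (R := ℤ))) n) =
      denom (extendZero x) n := by
    rw [← aeval_comp_extendZero x, ← map_denom]
    rfl
  have hN : MvPolynomial.aeval x (numer (extendZero (MvPolynomial.X (R := ℤ))) n c.blocks) =
      numer (extendZero x) n c.blocks := by
    rw [← aeval_comp_extendZero x, ← map_numer]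
    rfl
  have hD0 := denom_ne_zero hy
  have hw := weight_mul_denom hy c.blocks
    (mem_parts.2 ⟨fun a ha => c.blocks_pos ha, c.blocks_sum⟩)
  have hden : MvPolynomial.aeval x (den (ratWeight n c)) ≠ 0 := by
    have h := map_dvd (MvPolynomial.aeval x) (den_dvd (ratWeight_mul_denom c))
    rw [hD] at h
    exact ne_zero_of_dvd_ne_zero hD0 h
  have h := congrArg (MvPolynomial.aeval x) (num_mul_eq (ratWeight_mul_denom c))
  rw [map_mul, map_mul, hD, hN, ← hw] at h
  have : MvPolynomial.aeval x (num (ratWeight n c)) / MvPolynomial.aeval x (den (ratWeight n c)) =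
      weight (extendZero x) n c.blocks := by
    rw [div_eq_iff hden]
    apply mul_right_cancel₀ hD0
    rw [h]
    ring
  rw [HasValueAt, this]
  exact and_iff_right hden

theorem isStationaryRatFun_ratWeight (n : ℕ) : IsStationaryRatFun (n + 1) (ratWeight n) := by
  intro x hx π
  rw [isStationary_iff hx]
  exact forall_congr' fun c => (hasValueAt_ratWeight_iff hx c _).symm

theorem eq_of_aeval_eq {n : ℕ} {p q : MvPolynomial (Fin n) ℤ}
    (h : ∀ x : Fin n → ℝ, (∀ i, 0 < x i) → MvPolynomial.aeval x p = MvPolynomial.aeval x q) :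
    p = q := by
  apply MvPolynomial.map_injective (algebraMap ℤ ℝ) Int.cast_injective
  refine MvPolynomial.funext_set (fun _ => Set.Ioi (0 : ℝ)) (fun _ => Set.Ioi_infinite 0) ?_
  intro x hx
  rw [MvPolynomial.eval_map, MvPolynomial.eval_map]
  exact h x fun i => hx i trivial

/-- The cross-multiplied fractions agree on the open positive orthant, which suffices for equality
of polynomials. -/
theorem IsStationaryRatFun.eq_ratWeight {n : ℕ} {r : Composition (n + 1) → RatFun (n + 1)}
    (hr : IsStationaryRatFun (n + 1) r) : r = ratWeight n := by
  ext c
  rw [← IsFractionRing.num_mul_den_eq_num_mul_den_iff_eq (A := MvPolynomial (Fin (n + 1)) ℤ)]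
  refine eq_of_aeval_eq fun x hx => ?_
  have hadm : Admissible x := ⟨fun i => (hx i).le, fun i _ => hx i⟩
  have hstat := (isStationary_iff hadm _).2 fun _ => rfl
  obtain ⟨h1, h2⟩ := (hr x hadm _).1 hstat c
  obtain ⟨h3, h4⟩ := (isStationaryRatFun_ratWeight n x hadm _).1 hstat c
  rw [h2, div_eq_div_iff h1 h3] at h4
  rw [map_mul, map_mul]
  exact h4.symm

theorem denom_X_eq (n : ℕ) :
    denom (extendZero (MvPolynomial.X : Fin (n + 1) → MvPolynomial (Fin (n + 1)) ℤ)) n =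
      ∏ k ∈ Icc 1 n, y (n + 1) k ^ (n + 1 - k) :=
  prod_congr rfl fun k hk => by
    have := (mem_Icc.1 hk).2
    rw [y_eq_partialSum (by omega)]

/-! ### Sharpness of the exponents and the least common multiple. -/

theorem exists_y_pow_dvd_den {n k : ℕ} (hk : 1 ≤ k) (hkn : k ≤ n) :
    ∃ c : Composition (n + 1), y (n + 1) k ^ (n + 1 - k) ∣ den (ratWeight n c) := by
  obtain ⟨k, rfl⟩ : ∃ l, k = l + 1 := ⟨k - 1, by omega⟩
  obtain ⟨a, rfl⟩ : ∃ a, n = k + 1 + a := ⟨n - (k + 1), by omega⟩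
  obtain ⟨h1, h2⟩ := mem_parts.1 (hook_mem_parts a (k + 1))
  refine ⟨⟨(a + 1) :: List.replicate (k + 1) 1, fun {i} hi => h1 i hi, h2⟩, ?_⟩
  have hw := weight_hook_mul _ k a fun i hi => partialSum_algebraMap_ne_zero (n := k + 1 + a) i
    (Icc_subset_Icc_right (by omega) hi)
  simp only [← map_partialSum, ← map_prod, ← map_pow, ← map_mul, Function.comp] at hw
  have h := num_mul_eq (r := ratWeight (k + 1 + a) ⟨_, fun {i} hi => h1 i hi, h2⟩) hw
  have hp := prime_y (show k + 1 < k + 1 + a + 1 by omega)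
  rw [← y_eq_partialSum (by omega), extendZero_of_lt _ (show 1 < k + 1 + a + 1 by omega),
    extendZero_of_lt _ (show 0 < k + 1 + a + 1 by omega)] at h
  rw [show k + 1 + a + 1 - (k + 1) = a + 1 by omega]
  have hdvd := dvd_mul_of_dvd_right (dvd_mul_right (y (k + 1 + a + 1) (k + 1) ^ (a + 1))
    (∏ i ∈ Icc 1 k, partialSum (extendZero MvPolynomial.X) i))
    (num (ratWeight (k + 1 + a) ⟨_, fun {i} hi => h1 i hi, h2⟩))
  rw [h] at hdvd
  -- The other factor is a monomial in `x_0` and `x_1`, prime to `y_(k+1)`, so the whole power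
  -- divides the denominator.
  refine hp.pow_dvd_of_dvd_mul_left (a + 1) (fun hX => ?_) hdvd
  rcases hp.dvd_or_dvd hX with hX | hX
  · exact not_y_dvd_X hk (by omega) le_rfl (hp.dvd_of_dvd_pow hX)
  · exact not_y_dvd_X hk (by omega) zero_le_one (hp.dvd_of_dvd_pow hX)

theorem isLeastCommonMultiple_den (n : ℕ) :
    IsLeastCommonMultiple (fun c => den (ratWeight n c))
      (∏ k ∈ Icc 1 n, y (n + 1) k ^ (n + 1 - k)) := by
  constructor
  · intro c
    rw [← denom_X_eq]
    exact den_dvd (ratWeight_mul_denom c)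
  · intro W hW
    refine Finset.prod_dvd_of_isRelPrime ?_ ?_
    · intro j hj k hk hjk
      have hj := mem_Icc.1 (mem_coe.1 hj)
      have hk := mem_Icc.1 (mem_coe.1 hk)
      refine IsRelPrime.pow ?_
      exact ((prime_y (by omega)).irreducible.isRelPrime_iff_not_dvd).2
        (not_y_dvd_y hj.1 (by omega) (by omega) hjk)
    · intro k hk
      have hk := mem_Icc.1 hk
      obtain ⟨c, hc⟩ := exists_y_pow_dvd_den hk.1 hk.2
      exact hc.trans (hW c)

end HilbertGalton

theorem corollary2p6 (n : ℕ) (hn : 1 ≤ n) :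
    (∃! r : Composition n → HilbertGalton.RatFun n, HilbertGalton.IsStationaryRatFun n r) ∧
    ∀ Z : MvPolynomial (Fin n) ℤ,
      HilbertGalton.IsPartitionFunction n Z ↔
        Associated Z (∏ k ∈ Finset.Icc 1 (n - 1), HilbertGalton.y n k ^ (n - k)) := by
  obtain ⟨m, rfl⟩ : ∃ m, n = m + 1 := ⟨n - 1, by omega⟩
  have hlcm := HilbertGalton.isLeastCommonMultiple_den m
  rw [Nat.add_sub_cancel]
  refine ⟨⟨_, HilbertGalton.isStationaryRatFun_ratWeight m, fun r hr => hr.eq_ratWeight⟩,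
    fun Z => ⟨?_, fun h => ?_⟩⟩
  · rintro ⟨r, hr, hZ⟩
    rw [hr.eq_ratWeight] at hZ
    exact associated_of_dvd_dvd (hZ.2 _ hlcm.1) (hlcm.2 _ hZ.1)
  · exact ⟨_, HilbertGalton.isStationaryRatFun_ratWeight m,
      fun c => (hlcm.1 c).trans h.symm.dvd, fun W hW => h.dvd.trans (hlcm.2 W hW)⟩
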